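/- Let $F_2=\langle a,b\rangle$ be the free group on $a,b$. A \emph{generator pair} is a pair $(u,v)$ of elements generating $F_2$; an element is \emph{primitive} (a \emph{generator}) if it belongs to some generator pair. An element is \emph{positive} if its reduced word in $a^{\pm1},b^{\pm1}$ is cyclically reduced and all exponents of $a$ in it are positive (exponents of $b$ may be negative); a generator pair is positive if both members are. The primitive elements are enumerated, up to conjugation and inversion, by $\hat{\mathbb Q}=\mathbb Q\cup\{\infty\}$: start from the ordered edges with ends $0/1,\,1/0$ labelled $(a,b)$ and with ends $-1/0,\,0/1$ labelled $(b^{-1},a)$; whenever an edge with ends $p/q,\,r/s$ is labelled $(u,v)$, label the edge with ends $p/q,\,(p+r)/(q+s)$ by $(u,uv)$ and the edge with ends $(p+r)/(q+s),\,r/s$ by $(uv,v)$. Let $w_{p/q}$ be the label obtained at $p/q$ (for $\infty=\pm1/0$ it is defined up to inversion), and let $[p/q]$ be the set of all conjugates of $w_{p/q}$ and $w_{p/q}^{-1}$. A primitive element $u$ is of \emph{type} $\eta\in\{0/1,1/0,1/1\}$ if $u\in[p/q]$, where $p/q$, written in lowest terms, reduces to $\eta$ modulo $2$ (numerator and denominator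 separately). A generator pair $(u,v)$ is of type $(\eta,\eta')$ if $u,v$ are of types $\eta,\eta'$ respectively. Put $g_{0/1}=a$, $g_{1/0}=b$, $g_{1/1}=ab$. For $\eta\ne\eta'$, an element is \emph{palindromic with respect to $(\eta,\eta')$} if its reduced word in the basic generators $g_\eta^{\pm1},g_{\eta'}^{\pm1}$ reads the same forwards and backwards. \textbf{Proposition.} (1) Let $u\in F_2$ be primitive, positive and of type $\eta$. For each type $\eta'\neq\eta$ there is exactly one conjugate $u'$ of $u$ (necessarily primitive) that is positive and palindromic with respect to $(\eta,\eta')$. (2) Let $(u,v)$ be a positive generator pair of type $(\eta,\eta')$. There is exactly one generator pair $(u',v')$ of the form $(gug^{-1},gvg^{-1})$ with $g\in F_2$ such that $u'$ and $v'$ are both positive and both palindromic with respect to $(\eta,\eta')$. -/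

import Mathlib

/-- The free group on two generators. -/
abbrev F2 : Type := FreeGroup (Fin 2)

namespace F2

/-- The first free generator `a`. -/
def a : F2 := FreeGroup.of 0

/-- The second free generator `b`. -/
def b : F2 := FreeGroup.of 1

/-- `(u, v)` is a generator pair: `u` and `v` generate the free group of rank two. -/
def IsGeneratorPair (u v : F2) : Prop := Subgroup.closure ({u, v} : Set F2) = ⊤

/-- `u` is primitive (also called a generator): it is a member of some generator pair. -/
def IsPrimitive (u : F2) : Prop := ∃ v : F2, IsGeneratorPair u v

/-- `u` is positive: its reduced word in `a, b` is cyclically reduced, and all exponents of `a`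
in it are positive (no condition is put on the exponents of `b`). -/
def IsPositive (u : F2) : Prop :=
  FreeGroup.IsCyclicallyReduced u.toWord ∧ ∀ x ∈ u.toWord, x.1 = 0 → x.2 = true

/-- The standard generator pairs at the edges of the Farey tessellation. Here
`IsStandardPair u x v y` says that `u` and `v` are the standard words at the ends `x` and `y` of an
edge, `u` coming before `v`; a fraction `p/q` in lowest terms is recorded as the vector `(p, q)`, and
infinity as `1/0` or `-1/0`. The right half of the tessellation starts with `a` at `0/1` and `b` at
`1/0`, the left half with `b⁻¹` at `-1/0` and `a` at `0/1`. The third vertex of the triangle on the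
far side of an edge is found by Farey addition of the fractions and concatenation of the words. -/
inductive IsStandardPair : F2 → ℤ × ℤ → F2 → ℤ × ℤ → Prop
  | right : IsStandardPair a (0, 1) b (1, 0)
  | left : IsStandardPair b⁻¹ (-1, 0) a (0, 1)
  | fst {u v : F2} {x y : ℤ × ℤ} :
      IsStandardPair u x v y → IsStandardPair u x (u * v) (x + y)
  | snd {u v : F2} {x y : ℤ × ℤ} :
      IsStandardPair u x v y → IsStandardPair (u * v) (x + y) v y

/-- `w` is the standard word attached to the fraction `x = (p, q)`. -/
def IsStandardWord (w : F2) (x : ℤ × ℤ) : Prop :=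
  ∃ (v : F2) (y : ℤ × ℤ), IsStandardPair w x v y ∨ IsStandardPair v y w x

/-- `u` belongs to the extended conjugacy class `[p/q]`, where `x = (p, q)`: it is conjugate to the
standard word at `p/q` or to the inverse of that word. -/
def MemClass (u : F2) (x : ℤ × ℤ) : Prop :=
  ∃ w : F2, IsStandardWord w x ∧ (IsConj w u ∨ IsConj w⁻¹ u)

/-- The three mod 2 types `0/1`, `1/0` and `1/1`. -/
inductive ModTwoType : Type
  | zeroOne
  | oneZero
  | oneOne

/-- The residues mod 2 of the numerator and the denominator. -/
def ModTwoType.residues : ModTwoType → ZMod 2 × ZMod 2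
  | .zeroOne => (0, 1)
  | .oneZero => (1, 0)
  | .oneOne => (1, 1)

/-- `u` is of type `η`: it lies in a class `[p/q]` such that `p/q` reduces mod 2 to `η`. -/
def HasType (u : F2) (η : ModTwoType) : Prop :=
  ∃ p q : ℤ, MemClass u (p, q) ∧ ((p : ZMod 2), (q : ZMod 2)) = η.residues

/-- The basic generators: `a` for `0/1`, `b` for `1/0` and `ab` for `1/1`. -/
def basicGenerator : ModTwoType → F2
  | .zeroOne => a
  | .oneZero => b
  | .oneOne => a * b

/-- `u` is palindromic with respect to `(η, η')`, where `η ≠ η'`: the reduced word that expresses `u`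
in the basic generator pair of type `(η, η')` reads the same forwards and backwards. -/
def IsPalindromic (η η' : ModTwoType) (u : F2) : Prop :=
  η ≠ η' ∧ ∃ L : List (Fin 2 × Bool), FreeGroup.IsReduced L ∧ L.reverse = L ∧
    FreeGroup.lift ![basicGenerator η, basicGenerator η'] (FreeGroup.mk L) = u

/-- The pairs `(u, v)` and `(u', v')` are simultaneously conjugate. -/
def IsConjPair (u v u' v' : F2) : Prop :=
  ∃ g : F2, g * u * g⁻¹ = u' ∧ g * v * g⁻¹ = v'

end F2

/-!
Inverting both free generators is an automorphism `letterInv`, and a word in `a, b` is a palindrome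
exactly when `letterInv x = x⁻¹`. Palindromes in another basis are the images of such elements
under the automorphism `β` that carries `a, b` to this basis.

Existence of palindromic conjugates. For every pair `(u, v)` obtained from `(a, b)` by Nielsen moves
there is a palindrome `h` with `letterInv u = h * u⁻¹ * h⁻¹` and `letterInv v = h * v⁻¹ * h⁻¹`
(`IsNielsenPair.exists_letterInv_eq`). Writing `h = letterInv m * c * m⁻¹` with a middle part `c` of
at most one letter, and conjugating the pair by `m⁻¹`, one may replace `h` by `c`. If `c = 1`, both
conjugates are palindromes. Otherwise the product of `c` with the inverse of one of the conjugates
is a palindrome that contains an odd number of both letters, which is impossible; it is here that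
the types, that is the homology classes modulo 2, are used
(`IsNielsenPair.exists_palindromes`).

Uniqueness. If `p` and `g * p * g⁻¹` are palindromes, then `g⁻¹ * letterInv g` commutes with `p` and
so is a power of it, with even exponent because `p` has a nonzero class modulo 2. After
multiplication by a power of `p`, the element `g` is fixed by `letterInv`, hence trivial
(`conj_eq_self_of_palindrome`).

Positivity. Palindromes in each of the three bases are cyclically reduced in `a, b`
(`IsPalindromic.isCyclicallyReduced`), and cyclically reduced conjugates of positive elements are
positive (`IsPositive.of_isConj`).

An element with a type belongs to some Nielsen pair by the construction of the standard words. That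
every generator pair containing it is a Nielsen pair then follows from the special case of the
generator `a`: by a normal form argument, only the elements `a ^ m * b * a ^ n` and
`a ^ m * b⁻¹ * a ^ n` generate the group together with `a` (`exists_eq_of_isGeneratorPair_a`).
-/

open FreeGroup hiding map_one map_mul map_inv

namespace F2

/-! ### Reduced words -/

theorem toWord_mul_of_forall {x y : F2}
    (h : ∀ p ∈ x.toWord.getLast?, ∀ q ∈ y.toWord.head?, p.1 = q.1 → p.2 = q.2) :
    (x * y).toWord = x.toWord ++ y.toWord := by
  rw [toWord_mul]
  exact FreeGroup.IsReduced.reduce_eq (List.isChain_append.2 ⟨isReduced_toWord, isReduced_toWord, h⟩)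

/-- The automorphism of `F2` that inverts both free generators. The reversal of a word is the
composite of this automorphism with inversion, so palindromes are the solutions of
`letterInv x = x⁻¹`. -/
def letterInv : F2 →* F2 := FreeGroup.lift fun i => (FreeGroup.of i)⁻¹

@[simp] theorem letterInv_a : letterInv a = a⁻¹ := by simp [letterInv, a]

@[simp] theorem letterInv_b : letterInv b = b⁻¹ := by simp [letterInv, b]

theorem hom_ext {G : Type*} [Monoid G] {f g : F2 →* G} (ha : f a = g a) (hb : f b = g b) :
    f = g := by
  refine FreeGroup.ext_hom f g fun i => ?_
  fin_cases i
  exacts [ha, hb]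

@[simp] theorem letterInv_letterInv (x : F2) : letterInv (letterInv x) = x := by
  have : letterInv.comp letterInv = MonoidHom.id F2 := hom_ext (by simp) (by simp)
  exact DFunLike.congr_fun this x

theorem letterInv_mk (L : List (Fin 2 × Bool)) :
    letterInv (mk L) = mk (L.map fun p => (p.1, !p.2)) := by
  induction L with
  | nil => exact map_one _
  | cons p L ih =>
    have h1 : (mk (p :: L) : F2) = mk [p] * mk L := by simp
    have h2 : (mk ((p :: L).map fun p => (p.1, !p.2)) : F2) =
      mk [(p.1, !p.2)] * mk (L.map fun p => (p.1, !p.2)) := by simp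
    rw [h1, h2, map_mul, ih]
    obtain ⟨i, s⟩ := p
    cases s <;> simp [letterInv, FreeGroup.of, invRev]

theorem isReduced_map_not {L : List (Fin 2 × Bool)} (h : FreeGroup.IsReduced L) :
    FreeGroup.IsReduced (L.map fun p => (p.1, !p.2)) := by
  unfold FreeGroup.IsReduced at h ⊢
  rw [List.isChain_map]
  exact h.imp fun p q hpq => by simpa using hpq

theorem toWord_letterInv (x : F2) :
    (letterInv x).toWord = x.toWord.map fun p => (p.1, !p.2) := by
  conv_lhs => rw [← mk_toWord (x := x), letterInv_mk, toWord_mk]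
  exact (isReduced_map_not isReduced_toWord).reduce_eq

theorem letterInv_eq_inv_iff (x : F2) : letterInv x = x⁻¹ ↔ x.toWord.reverse = x.toWord := by
  rw [← toWord_inj, toWord_letterInv, toWord_inv, invRev, ← List.map_reverse,
    (List.map_injective_iff.2 _).eq_iff, eq_comm]
  rintro ⟨i, s⟩ ⟨j, t⟩ h
  simpa using h

/-- Only the trivial element is unchanged when all letters are inverted. -/
theorem eq_one_of_letterInv_eq {x : F2} (h : letterInv x = x) : x = 1 := by
  rw [← toWord_inj, toWord_letterInv] at h
  rw [← toWord_eq_nil_iff]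
  rcases hx : x.toWord with - | ⟨⟨i, s⟩, L⟩
  · rfl
  · simp [hx] at h

/-- A palindrome is the reversal of a word, followed by a middle part of at most one letter,
followed by that word. -/
theorem exists_middle_of_palindrome {x : F2} (h : letterInv x = x⁻¹) :
    ∃ m c : F2, x = letterInv m * c * m⁻¹ ∧ (c = 1 ∨ c = a ∨ c = a⁻¹ ∨ c = b ∨ c = b⁻¹) := by
  have key : ∀ L : List (Fin 2 × Bool), L.Palindrome → ∃ m c : F2,
      mk L = letterInv m * c * m⁻¹ ∧ (c = 1 ∨ c = a ∨ c = a⁻¹ ∨ c = b ∨ c = b⁻¹) := by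
    intro L hL
    induction hL with
    | nil => exact ⟨1, 1, by simp [← one_eq_mk], Or.inl rfl⟩
    | singleton p =>
      refine ⟨1, mk [p], by simp, ?_⟩
      obtain ⟨i, s⟩ := p
      fin_cases i <;> cases s <;> simp [a, b, FreeGroup.of, invRev]
    | cons_concat p _ ih =>
      rename_i l _
      obtain ⟨m, c, hm, hc⟩ := ih
      refine ⟨(mk [p])⁻¹ * m, c, ?_, hc⟩
      have h1 : (mk (p :: (l ++ [p])) : F2) = mk [p] * mk l * mk [p] := by simp
      have h2 : letterInv (mk [p])⁻¹ = mk [p] := by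
        rw [inv_mk, letterInv_mk]
        simp [invRev]
      rw [h1, hm, map_mul, h2]
      group
  have := key x.toWord (List.Palindrome.of_reverse_eq ((letterInv_eq_inv_iff x).1 h))
  rwa [mk_toWord] at this

/-! ### Elements that generate the group together with `a` -/

/-- The number of letters `b` and `b⁻¹` in the reduced word of `x`. -/
def countB (x : F2) : ℕ := x.toWord.countP fun p => p.1 = 1

/-- The reduced word of `x` is empty or starts with `b` or `b⁻¹`. -/
def HeadB (x : F2) : Prop := ∀ p ∈ x.toWord.head?, p.1 = 1

theorem getLast?_of_headB_inv {x : F2} (h : HeadB x⁻¹) : ∀ p ∈ x.toWord.getLast?, p.1 = 1 := by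
  intro p hp
  refine h (p.1, !p.2) ?_
  rw [toWord_inv, invRev, List.head?_reverse, List.getLast?_map]
  simp only [Option.mem_def] at hp
  simp [hp]

theorem countB_inv (x : F2) : countB x⁻¹ = countB x := by
  unfold countB
  rw [toWord_inv, invRev, List.countP_reverse, List.countP_map]
  rfl

theorem fst_eq_zero_of_mem_zpow (k : ℤ) {p : Fin 2 × Bool} (hp : p ∈ (a ^ k).toWord) :
    p.1 = 0 := by
  obtain ⟨n, rfl | rfl⟩ := k.eq_nat_or_neg
  · rw [zpow_natCast, a, toWord_of_pow] at hp
    rw [List.eq_of_mem_replicate hp]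
  · rw [zpow_neg, zpow_natCast, toWord_inv, a, toWord_of_pow] at hp
    simp only [invRev, List.map_replicate, List.reverse_replicate] at hp
    rw [List.eq_of_mem_replicate hp]

theorem countB_zpow (k : ℤ) : countB (a ^ k) = 0 := by
  unfold countB
  rw [List.countP_eq_zero]
  intro p hp
  simp [fst_eq_zero_of_mem_zpow k hp]

theorem countB_b : countB b = 1 := by
  simp [countB, b]

theorem b_ne_zpow (k : ℤ) : b ≠ a ^ k := fun h => by
  have := countB_b
  rw [h, countB_zpow] at this
  exact zero_ne_one this

theorem toWord_zpow_mul (k : ℤ) {y : F2} (hy : HeadB y) :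
    (a ^ k * y).toWord = (a ^ k).toWord ++ y.toWord := by
  refine toWord_mul_of_forall fun p hp q hq hpq => ?_
  rw [hy q hq, fst_eq_zero_of_mem_zpow k (List.mem_of_mem_getLast? hp)] at hpq
  exact absurd hpq (by decide)

theorem countB_zpow_mul (k : ℤ) {y : F2} (hy : HeadB y) : countB (a ^ k * y) = countB y := by
  have := countB_zpow k
  unfold countB at *
  rw [toWord_zpow_mul k hy, List.countP_append, this, zero_add]

/-- An initial power of `a` can be split off a reduced word. -/
theorem exists_zpow_mul_headB (x : F2) :
    ∃ (m : ℤ) (y : F2), x = a ^ m * y ∧ HeadB y ∧ y.toWord <:+ x.toWord := by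
  have key : ∀ L : List (Fin 2 × Bool), FreeGroup.IsReduced L → ∃ (m : ℤ) (y : F2),
      mk L = a ^ m * y ∧ HeadB y ∧ y.toWord <:+ L := by
    intro L hL
    induction L with
    | nil => exact ⟨0, 1, by simp [← one_eq_mk], by simp [HeadB], by simp⟩
    | cons p L ih =>
      obtain ⟨m, y, h1, h2, h3⟩ := ih (hL.infix ⟨[p], [], by simp⟩)
      have hp : (mk (p :: L) : F2) = mk [p] * mk L := by simp
      obtain ⟨i, s⟩ := p
      fin_cases i
      · have hs : ∃ e : ℤ, (mk [(0, s)] : F2) = a ^ e := by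
          cases s
          · exact ⟨-1, by simp [a, FreeGroup.of, invRev]⟩
          · exact ⟨1, by simp [a, FreeGroup.of]⟩
        obtain ⟨e, he⟩ := hs
        refine ⟨e + m, y, ?_, h2, h3.trans (List.suffix_cons _ _)⟩
        rw [hp, h1, zpow_add, mul_assoc, ← he]
        rfl
      · change FreeGroup.IsReduced ((1, s) :: L) at hL
        refine ⟨0, mk ((1, s) :: L), by simp, ?_, ?_⟩
        · rw [HeadB, toWord_mk, hL.reduce_eq]
          simp
        · rw [toWord_mk, hL.reduce_eq]
          exact List.suffix_rfl
  have := key x.toWord isReduced_toWord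
  rwa [mk_toWord] at this

/-- Powers of `a` can be split off both ends of a reduced word. -/
theorem exists_zpow_mul_mul_zpow (x : F2) :
    ∃ (m n : ℤ) (y : F2), x = a ^ m * y * a ^ n ∧ HeadB y ∧ HeadB y⁻¹ := by
  obtain ⟨m, y, h1, h2, -⟩ := exists_zpow_mul_headB x
  obtain ⟨n, z, h3, h4, h5⟩ := exists_zpow_mul_headB y⁻¹
  refine ⟨m, -n, z⁻¹, ?_, ?_, by rwa [inv_inv]⟩
  · rw [h1, mul_assoc, ← inv_inv y, h3]
    group
  · intro p hp
    obtain ⟨t, ht⟩ := h5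
    apply h2 p
    rw [toWord_inv] at ht hp
    have h6 : y.toWord = invRev z.toWord ++ invRev t := by
      rw [← invRev_invRev (L₁ := y.toWord), ← ht, invRev_append]
    rw [h6]
    exact List.mem_head?_append_of_mem_head? hp

theorem headB_pow {v : F2} (hv : HeadB v) (h2 : 2 ≤ countB v) {n : ℕ} (hn : n ≠ 0) :
    HeadB (v ^ n) ∧ 2 ≤ countB (v ^ n) := by
  obtain ⟨n, rfl⟩ := Nat.exists_eq_succ_of_ne_zero hn
  have h1 := reduceCyclically.reduce_flatten_replicate_succ (isReduced_toWord (x := v)) n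
  rw [← toWord_pow] at h1
  have h3 := reduceCyclically.conj_conjugator_reduceCyclically v.toWord
  set c := reduceCyclically.conjugator v.toWord
  set r := reduceCyclically v.toWord
  rw [List.replicate_succ, List.flatten_cons, ← List.append_assoc, List.append_assoc] at h1
  have hne : c ++ r ≠ [] := by
    intro h
    obtain ⟨hc, hr⟩ := List.append_eq_nil_iff.1 h
    rw [countB, ← h3, hc, hr] at h2
    simp at h2
  constructor
  · intro p hp
    apply hv p
    rw [← h3, List.head?_append_of_ne_nil _ hne]
    rwa [h1, List.head?_append_of_ne_nil _ hne] at hp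
  · unfold countB at *
    rw [← h3] at h2
    rw [h1]
    simp only [List.countP_append] at h2 ⊢
    omega

theorem headB_zpow {v : F2} (hv : HeadB v) (hv' : HeadB v⁻¹) (h2 : 2 ≤ countB v) {n : ℤ}
    (hn : n ≠ 0) : HeadB (v ^ n) ∧ HeadB (v ^ n)⁻¹ ∧ 2 ≤ countB (v ^ n) := by
  have h2' : 2 ≤ countB v⁻¹ := by rwa [countB_inv]
  obtain ⟨m, rfl | rfl⟩ := n.eq_nat_or_neg
  · have hm : m ≠ 0 := by simpa using hn
    rw [zpow_natCast, ← inv_pow]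
    exact ⟨(headB_pow hv h2 hm).1, (headB_pow hv' h2' hm).1, (headB_pow hv h2 hm).2⟩
  · have hm : m ≠ 0 := by simpa using hn
    rw [zpow_neg, inv_inv, zpow_natCast, ← inv_pow]
    exact ⟨(headB_pow hv' h2' hm).1, (headB_pow hv h2 hm).1, (headB_pow hv' h2' hm).2⟩

/-- Alternating products of nontrivial powers of `v` and of `a` that start with a power of `v`;
only the exponent of a final power of `a` may be zero. -/
inductive IsAlternating (v : F2) : F2 → Prop
  | base {n : ℤ} (hn : n ≠ 0) (k : ℤ) : IsAlternating v (v ^ n * a ^ k)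
  | cons {n k : ℤ} (hn : n ≠ 0) (hk : k ≠ 0) {y : F2} :
      IsAlternating v y → IsAlternating v (v ^ n * (a ^ k * y))

theorem zpow_mul_isAlternating {v y : F2} (hy : IsAlternating v y) (e : ℤ) :
    (∃ k : ℤ, v ^ e * y = a ^ k) ∨ ∃ (k : ℤ) (z : F2), IsAlternating v z ∧ v ^ e * y = a ^ k * z := by
  cases hy with
  | @base n hn k =>
    rw [← mul_assoc, ← zpow_add]
    by_cases h : e + n = 0
    · exact Or.inl ⟨k, by simp [h]⟩
    · exact Or.inr ⟨0, _, .base h k, by simp⟩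
  | @cons n k hn hk y hy =>
    rw [← mul_assoc, ← zpow_add]
    by_cases h : e + n = 0
    · exact Or.inr ⟨k, y, hy, by simp [h]⟩
    · exact Or.inr ⟨0, _, .cons h hk hy, by simp⟩

/-- Every element of the subgroup generated by `a` and `v` is an alternating product. -/
theorem isAlternating_of_mem_closure {v g : F2} (hg : g ∈ Subgroup.closure ({a, v} : Set F2)) :
    (∃ k : ℤ, g = a ^ k) ∨ ∃ (k : ℤ) (y : F2), IsAlternating v y ∧ g = a ^ k * y := by
  have ha : ∀ (e : ℤ) (y : F2),
      ((∃ k : ℤ, y = a ^ k) ∨ ∃ (k : ℤ) (z : F2), IsAlternating v z ∧ y = a ^ k * z) →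
      (∃ k : ℤ, a ^ e * y = a ^ k) ∨
        ∃ (k : ℤ) (z : F2), IsAlternating v z ∧ a ^ e * y = a ^ k * z := by
    rintro e y (⟨k, rfl⟩ | ⟨k, z, hz, rfl⟩)
    · exact Or.inl ⟨e + k, (zpow_add a e k).symm⟩
    · exact Or.inr ⟨e + k, z, hz, by rw [zpow_add, mul_assoc]⟩
  have hv : ∀ (e : ℤ) (y : F2), e ≠ 0 →
      ((∃ k : ℤ, y = a ^ k) ∨ ∃ (k : ℤ) (z : F2), IsAlternating v z ∧ y = a ^ k * z) →
      (∃ k : ℤ, v ^ e * y = a ^ k) ∨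
        ∃ (k : ℤ) (z : F2), IsAlternating v z ∧ v ^ e * y = a ^ k * z := by
    rintro e y he (⟨k, rfl⟩ | ⟨k, z, hz, rfl⟩)
    · exact Or.inr ⟨0, _, .base he k, by simp⟩
    · by_cases hk : k = 0
      · simpa [hk] using zpow_mul_isAlternating hz e
      · exact Or.inr ⟨0, _, .cons he hk hz, by simp⟩
  induction hg using Subgroup.closure_induction_left with
  | one => exact Or.inl ⟨0, by simp⟩
  | mul_left x hx y _ ih =>
    rcases hx with rfl | rfl
    · simpa using ha 1 y ih
    · simpa using hv 1 y one_ne_zero ih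
  | inv_mul_cancel x hx y _ ih =>
    rcases hx with rfl | rfl
    · simpa using ha (-1) y ih
    · simpa using hv (-1) y (by decide) ih

/-- If the reduced word of `v` starts and ends with `b` or `b⁻¹`, then no cancellation takes place
between the factors of an alternating product. -/
theorem IsAlternating.headB {v y : F2} (hv : HeadB v) (hv' : HeadB v⁻¹) (h2 : 2 ≤ countB v)
    (hy : IsAlternating v y) : HeadB y ∧ 2 ≤ countB y := by
  have key : ∀ {n : ℤ} {z : F2}, n ≠ 0 → (∀ q ∈ z.toWord.head?, q.1 = 0) →
      HeadB (v ^ n * z) ∧ 2 ≤ countB (v ^ n * z) := by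
    intro n z hn hz
    obtain ⟨h3, h4, h5⟩ := headB_zpow hv hv' h2 hn
    have hw : (v ^ n * z).toWord = (v ^ n).toWord ++ z.toWord := by
      refine toWord_mul_of_forall fun p hp q hq hpq => ?_
      rw [hz q hq, getLast?_of_headB_inv h4 p hp] at hpq
      exact absurd hpq (by decide)
    have hne : (v ^ n).toWord ≠ [] := by
      intro h
      rw [countB, h] at h5
      simp at h5
    constructor
    · intro p hp
      rw [hw, List.head?_append_of_ne_nil _ hne] at hp
      exact h3 p hp
    · unfold countB at *
      rw [hw, List.countP_append]
      omega
  induction hy with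
  | base hn k =>
    exact key hn fun q hq => fst_eq_zero_of_mem_zpow k (List.mem_of_mem_head? hq)
  | @cons n k hn hk y _ ih =>
    refine key hn fun q hq => ?_
    have hne : (a ^ k).toWord ≠ [] := by
      rw [Ne, toWord_eq_nil_iff, IsMulTorsionFree.zpow_eq_one_iff_left hk]
      exact of_ne_one 0
    rw [toWord_zpow_mul k ih.1, List.head?_append_of_ne_nil _ hne] at hq
    exact fst_eq_zero_of_mem_zpow k (List.mem_of_mem_head? hq)

/-- The only elements that complete `a` to a generator pair are the obvious ones. -/
theorem exists_eq_of_isGeneratorPair_a {v : F2} (h : IsGeneratorPair a v) :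
    ∃ m n : ℤ, v = a ^ m * b * a ^ n ∨ v = a ^ m * b⁻¹ * a ^ n := by
  obtain ⟨m, n, y, rfl, hy, hy'⟩ := exists_zpow_mul_mul_zpow v
  refine ⟨m, n, ?_⟩
  suffices y = b ∨ y = b⁻¹ by rcases this with rfl | rfl <;> simp
  have htop : b ∈ Subgroup.closure ({a, y} : Set F2) := by
    have hle : Subgroup.closure ({a, a ^ m * y * a ^ n} : Set F2) ≤ Subgroup.closure {a, y} := by
      have ha : a ∈ Subgroup.closure ({a, y} : Set F2) := Subgroup.subset_closure (by simp)
      have hy : y ∈ Subgroup.closure ({a, y} : Set F2) := Subgroup.subset_closure (by simp)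
      rw [Subgroup.closure_le]
      rintro x (rfl | rfl)
      · exact ha
      · exact mul_mem (mul_mem (zpow_mem ha m) hy) (zpow_mem ha n)
    rw [IsGeneratorPair] at h
    rw [h] at hle
    exact hle (Subgroup.mem_top b)
  rcases hw : y.toWord with - | ⟨⟨i, s⟩, t⟩
  · rw [toWord_eq_nil_iff] at hw
    rw [hw, Set.pair_comm, Subgroup.closure_insert_one, Subgroup.mem_closure_singleton] at htop
    obtain ⟨k, hk⟩ := htop
    exact absurd hk.symm (b_ne_zpow k)
  obtain rfl : i = 1 := hy (i, s) (by simp [hw])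
  rcases List.eq_nil_or_concat t with rfl | ⟨t, p, rfl⟩
  · rw [← mk_toWord (x := y), hw]
    cases s <;> simp [b, FreeGroup.of, invRev]
  · have hp : p.1 = 1 := getLast?_of_headB_inv hy' p (by simp [hw, List.getLast?_cons])
    have h2 : 2 ≤ countB y := by
      simp [countB, hw, hp]
    exfalso
    rcases isAlternating_of_mem_closure htop with ⟨k, hk⟩ | ⟨k, z, hz, hk⟩
    · exact b_ne_zpow k hk
    · have h3 := hz.headB hy hy' h2
      have h4 := countB_b
      rw [hk, countB_zpow_mul k h3.1] at h4
      omega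

/-- The centralizer of `a` consists of the powers of `a`. -/
theorem exists_zpow_of_commute_a {g : F2} (h : Commute g a) : ∃ k : ℤ, g = a ^ k := by
  obtain ⟨k, y, rfl, hy, -⟩ := exists_zpow_mul_headB g
  refine ⟨k, ?_⟩
  have hc : y * a = a * y := by
    have h1 : Commute (a ^ (-k) * (a ^ k * y)) a :=
      ((Commute.refl a).zpow_left (-k)).mul_left h
    simpa using h1.eq
  have h1 : (a * y).toWord = (0, true) :: y.toWord := by
    have := toWord_zpow_mul 1 hy
    rw [zpow_one] at this
    simpa [a] using this
  have h2 : (0, true) :: y.toWord = y.toWord ++ [(0, true)] := by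
    rw [← h1, ← hc]
    have h3 := toWord_mul_sublist y a
    have h4 : a.toWord = [(0, true)] := by simp [a]
    rw [h4] at h3
    refine h3.eq_of_length ?_
    rw [hc, h1]
    simp
  rcases hw : y.toWord with - | ⟨p, t⟩
  · rw [toWord_eq_nil_iff] at hw
    simp [hw]
  · have hp : p.1 = 1 := hy p (by simp [hw])
    rw [hw, List.cons_append] at h2
    rw [← (List.cons.inj h2).1] at hp
    exact absurd hp (by decide)

/-! ### Nielsen pairs -/

/-- The pairs obtained from `(a, b)` by Nielsen moves and simultaneous conjugation. -/
inductive IsNielsenPair : F2 → F2 → Prop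
  | base : IsNielsenPair a b
  | swap {u v : F2} : IsNielsenPair u v → IsNielsenPair v u
  | inv {u v : F2} : IsNielsenPair u v → IsNielsenPair u⁻¹ v
  | mul {u v : F2} : IsNielsenPair u v → IsNielsenPair u (u * v)
  | conj {u v : F2} (g : F2) : IsNielsenPair u v → IsNielsenPair (g * u * g⁻¹) (g * v * g⁻¹)

namespace IsNielsenPair

theorem mul_left {u v : F2} (h : IsNielsenPair u v) : IsNielsenPair (u * v) v := by
  simpa using h.inv.swap.inv.mul.swap.inv.swap.inv.swap

theorem zpow_mul {u v : F2} (h : IsNielsenPair u v) (m : ℤ) : IsNielsenPair u (u ^ m * v) := by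
  induction m using Int.induction_on with
  | zero => simpa using h
  | succ i ih =>
    rw [add_comm, zpow_one_add, mul_assoc]
    exact ih.mul
  | pred i ih =>
    rw [sub_eq_neg_add, zpow_add, zpow_neg_one, mul_assoc]
    simpa only [inv_inv] using ih.inv.mul.inv

/-- The members of a Nielsen pair are the images of the free generators under an automorphism. -/
theorem exists_mulEquiv {u v : F2} (h : IsNielsenPair u v) :
    ∃ ψ : F2 ≃* F2, ψ a = u ∧ ψ b = v := by
  induction h with
  | base => exact ⟨MulEquiv.refl _, rfl, rfl⟩
  | swap _ ih =>
    obtain ⟨ψ, rfl, rfl⟩ := ih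
    let f : F2 →* F2 := FreeGroup.lift ![b, a]
    have fa : f a = b := by simp [f, a]
    have fb : f b = a := by simp [f, b]
    let e : F2 ≃* F2 := f.toMulEquiv f (hom_ext (by simp [fa, fb]) (by simp [fa, fb]))
      (hom_ext (by simp [fa, fb]) (by simp [fa, fb]))
    exact ⟨e.trans ψ, congrArg ψ fa, congrArg ψ fb⟩
  | inv _ ih =>
    obtain ⟨ψ, rfl, rfl⟩ := ih
    let f : F2 →* F2 := FreeGroup.lift ![a⁻¹, b]
    have fa : f a = a⁻¹ := by simp [f, a]
    have fb : f b = b := by simp [f, b]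
    let e : F2 ≃* F2 := f.toMulEquiv f (hom_ext (by simp [fa]) (by simp [fb]))
      (hom_ext (by simp [fa]) (by simp [fb]))
    exact ⟨e.trans ψ, (congrArg ψ fa).trans (map_inv ψ a), congrArg ψ fb⟩
  | mul _ ih =>
    obtain ⟨ψ, rfl, rfl⟩ := ih
    let f : F2 →* F2 := FreeGroup.lift ![a, a * b]
    have fa : f a = a := by simp [f, a]
    have fb : f b = a * b := by simp [f, b]
    let f' : F2 →* F2 := FreeGroup.lift ![a, a⁻¹ * b]
    have fa' : f' a = a := by simp [f', a]
    have fb' : f' b = a⁻¹ * b := by simp [f', b]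
    let e : F2 ≃* F2 := f.toMulEquiv f' (hom_ext (by simp [fa, fa']) (by simp [fb, fa', fb']))
      (hom_ext (by simp [fa, fa']) (by simp [fb', fa, fb]))
    exact ⟨e.trans ψ, congrArg ψ fa, (congrArg ψ fb).trans (map_mul ψ a b)⟩
  | conj g _ ih =>
    obtain ⟨ψ, rfl, rfl⟩ := ih
    exact ⟨ψ.trans (MulAut.conj g), rfl, rfl⟩

/-- Inverting the letters inverts both members of a Nielsen pair up to a simultaneous conjugation,
and the conjugating element can be chosen to be a palindrome. -/
theorem exists_letterInv_eq {u v : F2} (h : IsNielsenPair u v) :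
    ∃ k : F2, letterInv k = k⁻¹ ∧ letterInv u = k * u⁻¹ * k⁻¹ ∧
      letterInv v = k * v⁻¹ * k⁻¹ := by
  induction h with
  | base => exact ⟨1, by simp, by simp, by simp⟩
  | swap _ ih =>
    obtain ⟨h, h0, h1, h2⟩ := ih
    exact ⟨h, h0, h2, h1⟩
  | inv _ ih =>
    obtain ⟨h, h0, h1, h2⟩ := ih
    exact ⟨h, h0, by rw [map_inv, h1]; group, h2⟩
  | @mul u v _ ih =>
    obtain ⟨h, h0, h1, h2⟩ := ih
    refine ⟨h * u⁻¹, ?_, ?_, ?_⟩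
    · rw [map_mul, map_inv, h0, h1]; group
    · rw [h1]; group
    · rw [map_mul, h1, h2]; group
  | @conj u v g _ ih =>
    obtain ⟨h, h0, h1, h2⟩ := ih
    refine ⟨letterInv g * h * g⁻¹, ?_, ?_, ?_⟩
    · simp only [map_mul, map_inv, letterInv_letterInv, h0]; group
    · simp only [map_mul, map_inv, h1]; group
    · simp only [map_mul, map_inv, h2]; group

end IsNielsenPair

theorem IsStandardPair.isNielsenPair {u v : F2} {x y : ℤ × ℤ} (h : IsStandardPair u x v y) :
    IsNielsenPair u v := by
  induction h with
  | right => exact .base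
  | left => exact .inv (.swap .base)
  | fst _ ih => exact ih.mul
  | snd _ ih => exact ih.mul_left

theorem isNielsenPair_basicGenerator {η η' : ModTwoType} (h : η ≠ η') :
    IsNielsenPair (basicGenerator η) (basicGenerator η') := by
  cases η <;> cases η'
  · exact absurd rfl h
  · exact .base
  · exact .mul .base
  · exact .swap .base
  · exact absurd rfl h
  · exact .swap (.mul_left .base)
  · exact .swap (.mul .base)
  · exact .mul_left .base
  · exact absurd rfl h

theorem IsNielsenPair.isGeneratorPair {u v : F2} (h : IsNielsenPair u v) : IsGeneratorPair u v := by
  obtain ⟨ψ, rfl, rfl⟩ := h.exists_mulEquiv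
  have hab : Subgroup.closure ({a, b} : Set F2) = ⊤ := by
    rw [← closure_range_of (Fin 2)]
    congr 1
    ext x
    simp [Fin.exists_fin_two, a, b, eq_comm]
  have h1 : Subgroup.map ψ.toMonoidHom ⊤ = ⊤ := Subgroup.map_top_of_surjective _ ψ.surjective
  rw [← hab, MonoidHom.map_closure, Set.image_pair, hab] at h1
  exact h1

theorem IsGeneratorPair.map {u v : F2} (h : IsGeneratorPair u v) (ψ : F2 ≃* F2) :
    IsGeneratorPair (ψ u) (ψ v) := by
  have h1 : Subgroup.map ψ.toMonoidHom ⊤ = ⊤ := Subgroup.map_top_of_surjective _ ψ.surjective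
  rw [IsGeneratorPair] at h
  rw [← h, MonoidHom.map_closure, Set.image_pair, h] at h1
  exact h1

/-- An element of a Nielsen pair forms a Nielsen pair with every element that completes it to a
generator pair. -/
theorem IsNielsenPair.of_isGeneratorPair {u v w : F2} (h : IsNielsenPair u v)
    (hw : IsGeneratorPair u w) : IsNielsenPair u w := by
  obtain ⟨ψ, hu, hv⟩ := h.exists_mulEquiv
  have h1 : IsGeneratorPair a (ψ.symm w) := by
    have := hw.map ψ.symm
    rwa [← hu, ψ.symm_apply_apply] at this
  have key : ∀ {t : F2} (m n : ℤ), IsNielsenPair u t → IsNielsenPair u (u ^ m * t * u ^ n) := by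
    intro t m n ht
    have h2 := (ht.zpow_mul (n + m)).conj (u ^ (-n))
    have h3 : u ^ (-n) * u * (u ^ (-n))⁻¹ = u := by group
    have h4 : u ^ (-n) * (u ^ (n + m) * t) * (u ^ (-n))⁻¹ = u ^ m * t * u ^ n := by group
    rwa [h3, h4] at h2
  obtain ⟨m, n, h2 | h2⟩ := exists_eq_of_isGeneratorPair_a h1
  · rw [← ψ.apply_symm_apply w, h2, map_mul, map_mul, map_zpow, map_zpow, hu, hv]
    exact key m n h
  · rw [← ψ.apply_symm_apply w, h2, map_mul, map_mul, map_zpow, map_zpow, map_inv, hu, hv]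
    exact key m n h.swap.inv.swap

/-- The centralizer of a member of a Nielsen pair consists of its powers. -/
theorem IsNielsenPair.exists_zpow_of_commute {u v g : F2} (h : IsNielsenPair u v)
    (hg : Commute g u) : ∃ k : ℤ, g = u ^ k := by
  obtain ⟨ψ, rfl, -⟩ := h.exists_mulEquiv
  have h1 : Commute (ψ.symm g) a := by simpa using hg.map ψ.symm
  obtain ⟨k, hk⟩ := exists_zpow_of_commute_a h1
  exact ⟨k, by rw [← map_zpow, ← hk, ψ.apply_symm_apply]⟩

/-! ### Types and homology modulo 2 -/

/-- The class of an element in the first homology group with coefficients in `ZMod 2`, in the order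
(exponent sum of `b`, exponent sum of `a`). -/
def modTwoClass : F2 →* Multiplicative (ZMod 2 × ZMod 2) :=
  FreeGroup.lift ![Multiplicative.ofAdd (0, 1), Multiplicative.ofAdd (1, 0)]

@[simp] theorem modTwoClass_a : modTwoClass a = Multiplicative.ofAdd (0, 1) := by
  simp [modTwoClass, a]

@[simp] theorem modTwoClass_b : modTwoClass b = Multiplicative.ofAdd (1, 0) := by
  simp [modTwoClass, b]

theorem inv_eq_self_of_zmod_two (x : Multiplicative (ZMod 2 × ZMod 2)) : x⁻¹ = x := by
  revert x
  decide

theorem modTwoClass_basicGenerator (η : ModTwoType) :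
    modTwoClass (basicGenerator η) = Multiplicative.ofAdd η.residues := by
  cases η
  · exact modTwoClass_a
  · exact modTwoClass_b
  · rw [basicGenerator, map_mul, modTwoClass_a, modTwoClass_b]
    rfl

theorem map_letterInv (f : F2 →* Multiplicative (ZMod 2 × ZMod 2)) (x : F2) :
    f (letterInv x) = f x := by
  have : f.comp letterInv = f := hom_ext (by simp [inv_eq_self_of_zmod_two])
    (by simp [inv_eq_self_of_zmod_two])
  exact DFunLike.congr_fun this x

theorem map_conj_eq (f : F2 →* Multiplicative (ZMod 2 × ZMod 2)) (g x : F2) :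
    f (g * x * g⁻¹) = f x := by
  rw [map_mul, map_mul, map_inv, mul_comm, inv_mul_cancel_left]

theorem IsNielsenPair.modTwoClass_ne {u v : F2} (h : IsNielsenPair u v) :
    modTwoClass u ≠ 1 ∧ modTwoClass v ≠ 1 ∧ modTwoClass u ≠ modTwoClass v := by
  induction h with
  | base =>
    rw [modTwoClass_a, modTwoClass_b]
    decide
  | swap _ ih => exact ⟨ih.2.1, ih.1, ih.2.2.symm⟩
  | inv _ ih => rwa [map_inv, inv_eq_self_of_zmod_two]
  | @mul u v _ ih =>
    rw [map_mul]
    obtain ⟨h1, h2, h3⟩ := ih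
    refine ⟨h1, fun h => h3 ?_, fun h => h2 (left_eq_mul.1 h)⟩
    rw [eq_inv_of_mul_eq_one_left h, inv_eq_self_of_zmod_two]
  | conj g _ ih => rwa [map_conj_eq, map_conj_eq]

theorem IsStandardPair.modTwoClass_eq {u v : F2} {x y : ℤ × ℤ} (h : IsStandardPair u x v y) :
    modTwoClass u = Multiplicative.ofAdd ((x.1 : ZMod 2), (x.2 : ZMod 2)) ∧
      modTwoClass v = Multiplicative.ofAdd ((y.1 : ZMod 2), (y.2 : ZMod 2)) := by
  induction h with
  | right => simp
  | left =>
    rw [map_inv, inv_eq_self_of_zmod_two]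
    simp
  | fst _ ih =>
    refine ⟨ih.1, ?_⟩
    rw [map_mul, ih.1, ih.2, ← ofAdd_add]
    simp
  | snd _ ih =>
    refine ⟨?_, ih.2⟩
    rw [map_mul, ih.1, ih.2, ← ofAdd_add]
    simp

/-- An element that has a type belongs to a Nielsen pair, and its type is its homology class. -/
theorem HasType.exists_isNielsenPair {u : F2} {η : ModTwoType} (h : HasType u η) :
    (∃ v, IsNielsenPair u v) ∧ modTwoClass u = Multiplicative.ofAdd η.residues := by
  obtain ⟨p, q, ⟨w, ⟨v, y, hw⟩, hc⟩, hpq⟩ := h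
  have h1 : (∃ v, IsNielsenPair w v) ∧ modTwoClass w = Multiplicative.ofAdd η.residues := by
    rw [← hpq]
    rcases hw with hw | hw
    · exact ⟨⟨v, hw.isNielsenPair⟩, hw.modTwoClass_eq.1⟩
    · exact ⟨⟨v, hw.isNielsenPair.swap⟩, hw.modTwoClass_eq.2⟩
  obtain ⟨⟨v, hv⟩, hη⟩ := h1
  rcases hc with hc | hc <;> obtain ⟨c, rfl⟩ := isConj_iff.1 hc
  · exact ⟨⟨_, hv.conj c⟩, by rw [map_conj_eq, hη]⟩
  · exact ⟨⟨_, hv.inv.conj c⟩, by rw [map_conj_eq, map_inv, inv_eq_self_of_zmod_two, hη]⟩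

/-! ### Palindromic conjugates -/

/-- A palindrome cannot contain an odd number of both letters. -/
theorem map_ne_of_palindrome (f : F2 →* Multiplicative (ZMod 2 × ZMod 2)) (ha : f a ≠ 1)
    (hb : f b ≠ 1) (hab : f a ≠ f b) {x : F2} (hx : letterInv x = x⁻¹) : f x ≠ f a * f b := by
  obtain ⟨m, c, rfl, hc⟩ := exists_middle_of_palindrome hx
  have h1 : f (letterInv m * c * m⁻¹) = f c := by
    rw [map_mul, map_mul, map_letterInv, map_inv, mul_comm, inv_mul_cancel_left]
  rw [h1]
  rcases hc with rfl | rfl | rfl | rfl | rfl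
  · intro h
    rw [map_one] at h
    exact hab (by rw [eq_inv_of_mul_eq_one_left h.symm, inv_eq_self_of_zmod_two])
  · simpa using hb
  · rw [map_inv, inv_eq_self_of_zmod_two]
    simpa using hb
  · simpa using ha
  · rw [map_inv, inv_eq_self_of_zmod_two]
    simpa using ha

/-- A Nielsen pair with the same homology classes as a basis `(β a, β b)` is simultaneously
conjugate to a pair of palindromes in that basis. -/
theorem IsNielsenPair.exists_palindromes {u v : F2} (h : IsNielsenPair u v) (β : F2 ≃* F2)
    (hβ : IsNielsenPair (β a) (β b)) (hu : modTwoClass u = modTwoClass (β a))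
    (hv : modTwoClass v = modTwoClass (β b)) :
    ∃ g x y : F2, letterInv x = x⁻¹ ∧ letterInv y = y⁻¹ ∧
      β x = g * u * g⁻¹ ∧ β y = g * v * g⁻¹ := by
  obtain ⟨k, hk, hka, hkb⟩ := hβ.exists_letterInv_eq
  obtain ⟨c, hc, hcu, hcv⟩ := h.exists_letterInv_eq
  have hconj : ∀ x, letterInv (β x) = k * β (letterInv x) * k⁻¹ := by
    have : letterInv.comp β.toMonoidHom =
        (MulAut.conj k).toMonoidHom.comp (β.toMonoidHom.comp letterInv) :=
      hom_ext (by simpa using hka) (by simpa using hkb)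
    exact fun x => DFunLike.congr_fun this x
  have hconj' : ∀ x, β (letterInv x) = k⁻¹ * letterInv (β x) * k := fun x => by
    rw [hconj]; group
  -- Pull everything back along `β`, so that the basis becomes `(a, b)`.
  obtain ⟨s, rfl⟩ := β.surjective u
  obtain ⟨t, rfl⟩ := β.surjective v
  obtain ⟨d, hd⟩ := β.surjective (k⁻¹ * c)
  have hds : letterInv s = d * s⁻¹ * d⁻¹ := β.injective <| by
    rw [hconj', hcu, map_mul, map_mul, map_inv, map_inv, hd]; group
  have hdt : letterInv t = d * t⁻¹ * d⁻¹ := β.injective <| by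
    rw [hconj', hcv, map_mul, map_mul, map_inv, map_inv, hd]; group
  have hdd : letterInv d = d⁻¹ := β.injective <| by
    rw [hconj', map_inv, hd, map_mul, map_inv, hc, hk]; group
  obtain ⟨m, e, rfl, he⟩ := exists_middle_of_palindrome hdd
  have hS : letterInv (m⁻¹ * s * m) = e * (m⁻¹ * s * m)⁻¹ * e⁻¹ := by
    rw [map_mul, map_mul, map_inv, hds]; group
  have hT : letterInv (m⁻¹ * t * m) = e * (m⁻¹ * t * m)⁻¹ * e⁻¹ := by
    rw [map_mul, map_mul, map_inv, hdt]; group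
  suffices e = 1 by
    subst this
    refine ⟨β m⁻¹, m⁻¹ * s * m, m⁻¹ * t * m, by simpa using hS, by simpa using hT, ?_, ?_⟩ <;>
      simp
  -- If `e` is a letter, multiply it with the inverse of the element that has the class of the other
  -- basis element: this gives a palindrome with an odd number of both letters.
  obtain ⟨ha, hb, hab⟩ := hβ.modTwoClass_ne
  have hne := fun {x : F2} =>
    map_ne_of_palindrome (modTwoClass.comp β.toMonoidHom) ha hb hab (x := x)
  have key : ∀ r : F2, letterInv e = e⁻¹ → letterInv r = e * r⁻¹ * e⁻¹ →
      letterInv (e * r⁻¹) = (e * r⁻¹)⁻¹ := fun r h1 h2 => by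
    rw [map_mul, map_inv, h1, h2]; group
  have hs' : modTwoClass (β (m⁻¹ * s * m)) = modTwoClass (β a) := by
    simp [← hu]
  have ht' : modTwoClass (β (m⁻¹ * t * m)) = modTwoClass (β b) := by
    simp [← hv]
  have h1 : ∀ x y, modTwoClass (β (x * y⁻¹)) = modTwoClass (β x) * modTwoClass (β y) := by
    intro x y
    rw [map_mul, map_mul, map_inv, map_inv, inv_eq_self_of_zmod_two]
  have h2 : ∀ x, modTwoClass (β x⁻¹) = modTwoClass (β x) := by
    intro x
    rw [map_inv, map_inv, inv_eq_self_of_zmod_two]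
  rcases he with he | he | he | he | he
  · exact he
  · refine absurd ((h1 _ _).trans ?_) (hne (key _ (by simp [he]) hT))
    rw [ht', he]
    rfl
  · refine absurd ((h1 _ _).trans ?_) (hne (key _ (by simp [he]) hT))
    rw [ht', he, h2]
    rfl
  · refine absurd ((h1 _ _).trans ?_) (hne (key _ (by simp [he]) hS))
    rw [hs', he, mul_comm]
    rfl
  · refine absurd ((h1 _ _).trans ?_) (hne (key _ (by simp [he]) hS))
    rw [hs', he, h2, mul_comm]
    rfl

/-- Conjugate palindromes are equal if they have a nonzero homology class and only their powers
commute with them. -/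
theorem conj_eq_self_of_palindrome {p g : F2} (f : F2 →* Multiplicative (ZMod 2 × ZMod 2))
    (hf : f p ≠ 1) (hp : letterInv p = p⁻¹) (hg : letterInv (g * p * g⁻¹) = (g * p * g⁻¹)⁻¹)
    (hc : ∀ z, Commute z p → ∃ k : ℤ, z = p ^ k) : g * p * g⁻¹ = p := by
  have hcomm : Commute (g⁻¹ * letterInv g) p := by
    rw [map_mul, map_mul, map_inv, hp, ← inv_inj] at hg
    have h1 : letterInv g * p * (letterInv g)⁻¹ = g * p * g⁻¹ := by
      simpa [mul_assoc] using hg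
    have h2 : letterInv g * p = g * p * g⁻¹ * letterInv g := by
      rw [← h1, inv_mul_cancel_right]
    rw [Commute, SemiconjBy, mul_assoc, h2]
    group
  obtain ⟨k, hk⟩ := hc _ hcomm
  have hfk : f p ^ k = 1 := by
    rw [← map_zpow, ← hk, map_mul, map_inv, map_letterInv, inv_mul_cancel]
  have hsq : ∀ j : ℤ, f p ^ (2 * j) = 1 := fun j => by
    rw [zpow_mul, zpow_two]
    nth_rw 1 [← inv_eq_self_of_zmod_two (f p)]
    rw [inv_mul_cancel, one_zpow]
  obtain ⟨j, rfl | rfl⟩ := k.even_or_odd'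
  · -- Modulo the centralizer of `p`, the conjugating element is invariant under `letterInv`.
    have h1 : letterInv (g * p ^ j) = g * p ^ j := by
      rw [inv_mul_eq_iff_eq_mul] at hk
      rw [map_mul, map_zpow, hk, hp]
      group
    have h2 : g = p ^ (-j) := by
      rw [zpow_neg]
      exact eq_inv_of_mul_eq_one_left (eq_one_of_letterInv_eq h1)
    rw [h2]
    group
  · rw [zpow_add_one, hsq, one_mul] at hfk
    exact absurd hfk hf

theorem isPalindromic_iff {η η' : ModTwoType} {β : F2 ≃* F2} (ha : β a = basicGenerator η)
    (hb : β b = basicGenerator η') (h : η ≠ η') (u : F2) :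
    IsPalindromic η η' u ↔ ∃ x, letterInv x = x⁻¹ ∧ β x = u := by
  have hβ : ∀ x, FreeGroup.lift ![basicGenerator η, basicGenerator η'] x = β x := by
    have : FreeGroup.lift ![basicGenerator η, basicGenerator η'] = β.toMonoidHom :=
      hom_ext (by simpa [a] using ha.symm) (by simpa [b] using hb.symm)
    exact fun x => DFunLike.congr_fun this x
  constructor
  · rintro ⟨-, L, h1, h2, h3⟩
    refine ⟨mk L, ?_, by rw [← hβ, h3]⟩
    rw [letterInv_eq_inv_iff, toWord_mk, h1.reduce_eq, h2]
  · rintro ⟨x, h1, h2⟩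
    refine ⟨h, x.toWord, isReduced_toWord, (letterInv_eq_inv_iff x).1 h1, ?_⟩
    rw [mk_toWord, hβ, h2]

theorem ne_of_residues {u v : F2} {η η' : ModTwoType} (h : IsNielsenPair u v)
    (hu : modTwoClass u = Multiplicative.ofAdd η.residues)
    (hv : modTwoClass v = Multiplicative.ofAdd η'.residues) : η ≠ η' := by
  rintro rfl
  exact h.modTwoClass_ne.2.2 (hu.trans hv.symm)

theorem IsNielsenPair.exists_isPalindromic {u v : F2} {η η' : ModTwoType} (h : IsNielsenPair u v)
    (hu : modTwoClass u = Multiplicative.ofAdd η.residues)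
    (hv : modTwoClass v = Multiplicative.ofAdd η'.residues) :
    ∃ g : F2, IsPalindromic η η' (g * u * g⁻¹) ∧ IsPalindromic η η' (g * v * g⁻¹) := by
  have hne := ne_of_residues h hu hv
  have hβ := isNielsenPair_basicGenerator hne
  obtain ⟨β, ha, hb⟩ := hβ.exists_mulEquiv
  rw [← modTwoClass_basicGenerator, ← ha] at hu
  rw [← modTwoClass_basicGenerator, ← hb] at hv
  rw [← ha, ← hb] at hβ
  obtain ⟨g, x, y, hx, hy, hxu, hyv⟩ := h.exists_palindromes β hβ hu hv
  exact ⟨g, (isPalindromic_iff ha hb hne _).2 ⟨x, hx, hxu⟩,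
    (isPalindromic_iff ha hb hne _).2 ⟨y, hy, hyv⟩⟩

theorem IsPalindromic.swap {η η' : ModTwoType} {u : F2} (h : IsPalindromic η η' u) :
    IsPalindromic η' η u := by
  have hne := h.1
  obtain ⟨β, ha, hb⟩ := (isNielsenPair_basicGenerator hne).exists_mulEquiv
  obtain ⟨σ, hσa, hσb⟩ := IsNielsenPair.base.swap.exists_mulEquiv
  obtain ⟨x, hx, rfl⟩ := (isPalindromic_iff ha hb hne u).1 h
  refine (isPalindromic_iff (β := σ.trans β) (by simp [hσa, hb]) (by simp [hσb, ha]) hne.symm _).2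
    ⟨σ.symm x, ?_, by simp⟩
  have : letterInv.comp σ.toMonoidHom = σ.toMonoidHom.comp letterInv :=
    hom_ext (by simp [hσa]) (by simp [hσb])
  have h1 := DFunLike.congr_fun this (σ.symm x)
  refine σ.injective (h1.symm.trans ?_)
  simp [hx]

/-- Conjugate elements of a Nielsen pair that are palindromic with respect to the same types are
equal. -/
theorem IsNielsenPair.eq_of_isPalindromic {u v u' : F2} {η η' : ModTwoType}
    (h : IsNielsenPair u v) (hc : IsConj u u') (hu : IsPalindromic η η' u)
    (hu' : IsPalindromic η η' u') : u' = u := by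
  have hne := hu.1
  obtain ⟨β, ha, hb⟩ := (isNielsenPair_basicGenerator hne).exists_mulEquiv
  obtain ⟨x, hx, rfl⟩ := (isPalindromic_iff ha hb hne u).1 hu
  obtain ⟨y, hy, rfl⟩ := (isPalindromic_iff ha hb hne u').1 hu'
  obtain ⟨c, hc⟩ := isConj_iff.1 hc
  obtain ⟨g, rfl⟩ := β.surjective c
  rw [← map_inv, ← map_mul, ← map_mul] at hc
  obtain rfl := β.injective hc
  congr 1
  refine conj_eq_self_of_palindrome (modTwoClass.comp β.toMonoidHom) h.modTwoClass_ne.1 hx hy ?_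
  intro z hz
  obtain ⟨k, hk⟩ := h.exists_zpow_of_commute (hz.map β)
  exact ⟨k, β.injective (by rw [hk, map_zpow])⟩

/-! ### Positivity -/

theorem isCyclicallyReduced_toWord_inv {x : F2} (h : IsCyclicallyReduced x⁻¹.toWord) :
    IsCyclicallyReduced x.toWord := by
  refine ⟨isReduced_toWord, fun p hp q hq hpq => ?_⟩
  have h1 := h.2 (q.1, !q.2) ?_ (p.1, !p.2) ?_ hpq.symm
  · simpa using h1.symm
  · rw [toWord_inv, invRev, List.getLast?_reverse, List.head?_map]
    simp only [Option.mem_def] at hq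
    simp [hq]
  · rw [toWord_inv, invRev, List.head?_reverse, List.getLast?_map]
    simp only [Option.mem_def] at hp
    simp [hp]

theorem head?_eq_getLast?_of_palindrome {x : F2} (hx : letterInv x = x⁻¹) :
    x.toWord.head? = x.toWord.getLast? := by
  conv_lhs => rw [← (letterInv_eq_inv_iff x).1 hx, List.head?_reverse]

theorem isCyclicallyReduced_of_palindrome {x : F2} (hx : letterInv x = x⁻¹) :
    IsCyclicallyReduced x.toWord := by
  refine ⟨isReduced_toWord, fun p hp q hq _ => ?_⟩
  rw [head?_eq_getLast?_of_palindrome hx] at hq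
  rw [Option.mem_unique hp hq]

/-- The product of a palindrome and a letter is cyclically reduced. -/
theorem isCyclicallyReduced_mul_of_palindrome {x : F2} (hx : letterInv x = x⁻¹) (l : Fin 2 × Bool) :
    IsCyclicallyReduced (x * mk [l]).toWord := by
  have hl : (mk [l] : F2).toWord = [l] := by
    rw [toWord_mk, reduce_singleton]
  have hht := head?_eq_getLast?_of_palindrome hx
  by_cases hlast : ∀ p ∈ x.toWord.getLast?, p.1 = l.1 → p.2 = l.2
  · -- The letter does not cancel.
    have hw : (x * mk [l]).toWord = x.toWord ++ [l] := by
      rw [toWord_mul_of_forall, hl]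
      intro p hp q hq
      rw [hl, List.head?_cons, Option.mem_some_iff] at hq
      rw [← hq]
      exact hlast p hp
    refine ⟨isReduced_toWord, ?_⟩
    rw [hw, List.getLast?_concat]
    intro p hp q hq hpq
    obtain rfl := Option.mem_some_iff.1 hp
    rcases hx0 : x.toWord with - | ⟨r, t⟩
    · rw [hx0, List.nil_append, List.head?_cons, Option.mem_some_iff] at hq
      rw [hq]
    · rw [hx0, List.cons_append, List.head?_cons, Option.mem_some_iff] at hq
      subst hq
      exact (hlast r (by rw [← hht, hx0]; rfl) hpq.symm).symm
  · -- The letter cancels against the last letter of the palindrome.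
    push Not at hlast
    obtain ⟨p, hp, hp1, hp2⟩ := hlast
    obtain rfl : p = (l.1, !l.2) := Prod.ext hp1 (Bool.eq_not_of_ne hp2)
    have hpal := List.Palindrome.of_reverse_eq ((letterInv_eq_inv_iff x).1 hx)
    have hred : FreeGroup.IsReduced x.toWord := isReduced_toWord
    have hcancel : ∀ t : List (Fin 2 × Bool), x.toWord = t ++ [(l.1, !l.2)] →
        (x * mk [l]).toWord = t := by
      intro t ht
      have h1 : x = mk t * (mk [l])⁻¹ := by
        rw [← mk_toWord (x := x), ht, inv_mk, mul_mk]
        rfl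
      rw [h1, inv_mul_cancel_right, toWord_mk]
      exact (hred.infix ⟨[], [(l.1, !l.2)], by simp [ht]⟩).reduce_eq
    generalize x.toWord = L at hp hpal hred hcancel
    cases hpal with
    | nil => simp at hp
    | singleton q =>
      obtain rfl : q = (l.1, !l.2) := by simpa using hp
      rw [hcancel [] rfl]
      exact IsCyclicallyReduced.nil
    | @cons_concat q t ht =>
      rw [← List.cons_append] at hp hred hcancel
      rw [List.getLast?_concat, Option.mem_some_iff] at hp
      rw [hcancel (q :: t) (by rw [hp])]
      refine ⟨hred.infix ⟨[], [q], by simp⟩, ?_⟩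
      rcases t with - | ⟨r, t⟩
      · simp
      · have hr : (q :: r :: t).getLast? = some r := by
          rw [List.getLast?_cons_cons, ← List.head?_reverse, ht.reverse_eq, List.head?_cons]
        rw [hr]
        intro p hp' q' hq' hpq
        obtain rfl := Option.mem_some_iff.1 hp'
        obtain rfl := Option.mem_some_iff.1 hq'
        exact ((isReduced_cons_cons.1 hred).1 hpq.symm).symm

/-- A cyclically reduced conjugate of a positive element is positive: the reduced words of its powers
are powers of its reduced word, and a conjugation adds only a bounded number of letters `a⁻¹`. -/
theorem IsPositive.of_isConj {u u' : F2} (hu : IsPositive u) (hc : IsConj u u')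
    (hu' : IsCyclicallyReduced u'.toWord) : IsPositive u' := by
  refine ⟨hu', ?_⟩
  rintro ⟨i, s⟩ hp rfl
  by_contra hs
  obtain rfl : s = false := by simpa using hs
  have hpow : ∀ {x : F2}, IsCyclicallyReduced x.toWord → ∀ n : ℕ,
      (x ^ n).toWord = (List.replicate n x.toWord).flatten := fun {x} hx n => by
    rw [toWord_pow, (hx.flatten_replicate n).isReduced.reduce_eq]
  obtain ⟨g, rfl⟩ := isConj_iff.1 hc
  set N : F2 → ℕ := fun x => x.toWord.count (0, false) with hN
  have hmul : ∀ x y, N (x * y) ≤ N x + N y := fun x y => by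
    simpa [hN, List.count_append] using (toWord_mul_sublist x y).count_le (0, false)
  have h1 : ∀ n : ℕ, n ≤ N g + N g⁻¹ := fun n => by
    have h2 : n ≤ N ((g * u * g⁻¹) ^ n) := by
      simp only [hN, hpow hu' n, List.count_flatten, List.map_replicate, List.sum_replicate]
      exact Nat.le_mul_of_pos_right n (List.count_pos_iff.2 hp)
    have h3 : N (u ^ n) = 0 := by
      simp only [hN, hpow hu.1 n, List.count_eq_zero, List.mem_flatten]
      rintro ⟨l, hl, h4⟩
      rw [List.eq_of_mem_replicate hl] at h4
      simpa using hu.2 _ h4 rfl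
    rw [conj_pow] at h2
    have h5 := hmul (g * u ^ n) g⁻¹
    have h6 := hmul g (u ^ n)
    omega
  have := h1 (N g + N g⁻¹ + 1)
  omega

theorem IsPalindromic.isCyclicallyReduced {η η' : ModTwoType} {u : F2}
    (h : IsPalindromic η η' u) : IsCyclicallyReduced u.toWord := by
  -- The order of the two types does not matter, so that there are three cases.
  wlog hle : (η, η') = (.zeroOne, .oneZero) ∨ (η, η') = (.zeroOne, .oneOne) ∨
      (η, η') = (.oneZero, .oneOne) generalizing η η'
  · refine this h.swap ?_
    have := h.1
    cases η <;> cases η' <;> simp_all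
  have hne := h.1
  obtain ⟨β, ha, hb⟩ := (isNielsenPair_basicGenerator hne).exists_mulEquiv
  obtain ⟨x, hx, rfl⟩ := (isPalindromic_iff ha hb hne u).1 h
  have hconj : ∀ k : F2, letterInv (β a) = k * β a⁻¹ * k⁻¹ → letterInv (β b) = k * β b⁻¹ * k⁻¹ →
      letterInv (β x) = k * (β x)⁻¹ * k⁻¹ := by
    intro k h1 h2
    have : letterInv.comp β.toMonoidHom =
        (MulAut.conj k).toMonoidHom.comp (β.toMonoidHom.comp letterInv) :=
      hom_ext (by simpa using h1) (by simpa using h2)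
    have h3 := DFunLike.congr_fun this x
    simpa [hx] using h3
  rcases hle with hle | hle | hle <;> obtain ⟨rfl, rfl⟩ := Prod.mk.inj hle <;>
    simp only [basicGenerator] at ha hb
  · refine isCyclicallyReduced_of_palindrome ?_
    simpa using hconj 1 (by simp [ha]) (by simp [hb])
  · -- In the basis `a, ab`, the palindromes are the products of `a` with palindromes in `a, b`.
    have h1 := hconj a⁻¹ (by simp [ha]) (by simp [hb, mul_assoc])
    have h2 : letterInv ((β x)⁻¹ * a) = ((β x)⁻¹ * a)⁻¹ := by
      rw [map_mul, map_inv, h1, letterInv_a]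
      group
    have h3 := isCyclicallyReduced_mul_of_palindrome h2 (0, false)
    have h4 : (mk [(0, false)] : F2) = a⁻¹ := by simp [a, FreeGroup.of, invRev]
    rw [h4, mul_inv_cancel_right] at h3
    exact isCyclicallyReduced_toWord_inv h3
  · -- In the basis `b, ab`, they are the products of palindromes in `a, b` with `b`.
    have h1 := hconj b (by simp [ha]) (by simp [hb])
    have h2 : letterInv (β x * b⁻¹) = (β x * b⁻¹)⁻¹ := by
      rw [map_mul, map_inv, h1, letterInv_b]
      group
    have h3 := isCyclicallyReduced_mul_of_palindrome h2 (1, true)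
    have h4 : (mk [(1, true)] : F2) = b := rfl
    rwa [h4, inv_mul_cancel_right] at h3

/-! ### Existence and uniqueness of positive palindromic conjugates -/

/-- Every Nielsen pair can be altered to one whose second member has a prescribed type different
from that of the first. -/
theorem IsNielsenPair.exists_of_residues {u v : F2} {η η' : ModTwoType} (h : IsNielsenPair u v)
    (hu : modTwoClass u = Multiplicative.ofAdd η.residues) (hne : η' ≠ η) :
    ∃ w, IsNielsenPair u w ∧ modTwoClass w = Multiplicative.ofAdd η'.residues := by
  have key : ∀ y : Multiplicative (ZMod 2 × ZMod 2), y ≠ 1 →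
      y ≠ Multiplicative.ofAdd η.residues → y = Multiplicative.ofAdd η'.residues ∨
        Multiplicative.ofAdd η.residues * y = Multiplicative.ofAdd η'.residues := by
    cases η <;> cases η' <;> first | exact absurd rfl hne | (simp only [ModTwoType.residues]; decide)
  obtain ⟨-, h1, h2⟩ := h.modTwoClass_ne
  rcases key _ h1 (hu ▸ h2.symm) with h3 | h3
  · exact ⟨v, h, h3⟩
  · exact ⟨u * v, h.mul, by rw [map_mul, hu, h3]⟩

end F2

theorem mainTheorem3 :
    (∀ (u : F2) (η : F2.ModTwoType),
      F2.IsPrimitive u → F2.IsPositive u → F2.HasType u η →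
      ∀ η' : F2.ModTwoType, η' ≠ η →
        ∃! u' : F2, IsConj u u' ∧ F2.IsPrimitive u' ∧
          F2.IsPositive u' ∧ F2.IsPalindromic η η' u') ∧
    (∀ (u v : F2) (η η' : F2.ModTwoType),
      F2.IsGeneratorPair u v → F2.IsPositive u → F2.IsPositive v →
      F2.HasType u η → F2.HasType v η' →
        ∃! w : F2 × F2, F2.IsConjPair u v w.1 w.2 ∧ F2.IsGeneratorPair w.1 w.2 ∧
          F2.IsPositive w.1 ∧ F2.IsPositive w.2 ∧
          F2.IsPalindromic η η' w.1 ∧ F2.IsPalindromic η η' w.2) := by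
  constructor
  · intro u η _ hpos hu η' hne
    obtain ⟨⟨v, hv⟩, hη⟩ := hu.exists_isNielsenPair
    obtain ⟨w, hw, hη'⟩ := hv.exists_of_residues hη hne
    obtain ⟨g, hg, -⟩ := hw.exists_isPalindromic hη hη'
    have hc : IsConj u (g * u * g⁻¹) := isConj_iff.2 ⟨g, rfl⟩
    refine ⟨g * u * g⁻¹, ⟨hc, ⟨_, (hw.conj g).isGeneratorPair⟩,
      hpos.of_isConj hc hg.isCyclicallyReduced, hg⟩, ?_⟩
    rintro u' ⟨hc', -, -, hu'⟩
    exact (hw.conj g).eq_of_isPalindromic (hc.symm.trans hc') hg hu'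
  · intro u v η η' hgen hpu hpv hu hv
    obtain ⟨⟨v', hv'⟩, hη⟩ := hu.exists_isNielsenPair
    have hη' := hv.exists_isNielsenPair.2
    have huv := hv'.of_isGeneratorPair hgen
    obtain ⟨g, hgu, hgv⟩ := huv.exists_isPalindromic hη hη'
    have hcu : IsConj u (g * u * g⁻¹) := isConj_iff.2 ⟨g, rfl⟩
    have hcv : IsConj v (g * v * g⁻¹) := isConj_iff.2 ⟨g, rfl⟩
    refine ⟨(g * u * g⁻¹, g * v * g⁻¹), ⟨⟨g, rfl, rfl⟩, (huv.conj g).isGeneratorPair,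
      hpu.of_isConj hcu hgu.isCyclicallyReduced, hpv.of_isConj hcv hgv.isCyclicallyReduced,
      hgu, hgv⟩, ?_⟩
    rintro ⟨u', w'⟩ ⟨⟨c, hc1, hc2⟩, -, -, -, hu', hw'⟩
    exact Prod.ext
      ((huv.conj g).eq_of_isPalindromic (hcu.symm.trans (isConj_iff.2 ⟨c, hc1⟩)) hgu hu')
      ((huv.conj g).swap.eq_of_isPalindromic (hcv.symm.trans (isConj_iff.2 ⟨c, hc2⟩)) hgv hw')
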